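/- For positive integers $m,n$, let $S_{m\times n}$ be the graph with vertex set $\{1,\dots,m\}\times\{1,\dots,n\}\subset\mathbb{Z}^2$ in which two vertices are adjacent if and only if they are at Euclidean distance $1$ and are not both in the leftmost column $\{x=1\}$ nor both in the rightmost column $\{x=m\}$. A left-right crossing path is a path in $S_{m\times n}$ from some vertex $(1,y)$ to some vertex $(m,y')$. In the $(p,q)$-crossing game on $S_{m\times n}$ two players, Maker and Breaker, take alternating turns, with Maker playing first; on each of her turns Maker claims $p$ as-yet-unclaimed edges of $S_{m\times n}$, and on each of his turns Breaker claims $q$ as-yet-unclaimed edges (a player claims all remaining edges if there are fewer than required). Maker wins if she claims all the edges of a left-right crossing path; Breaker wins if a state is reached in which every left-right crossing path contains an edge claimed by Breaker, so that Maker can no longer ever claim such a path. **Proposition.** Let $p,m,n$ be positive integers. (i) If $m\le n+1$, then Maker has a winning strategy for the $(p,p)$-crossing game on $S_{m\times n}$. (ii) If $m\ge (p+1)(n+1)$, then Breaker has a winning strategy for the $(p,p)$-crossing game on $S_{m\times n}$. -/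

import Mathlib

namespace CrossingGame

/-- The square integer lattice: `ℤ²`, with edges between the pairs at Euclidean distance `1`. -/
def squareLattice : SimpleGraph (ℤ × ℤ) where
  Adj v w := (v.1 - w.1) ^ 2 + (v.2 - w.2) ^ 2 = 1
  symm := ⟨fun v w h => by rw [← h]; ring⟩
  loopless := ⟨fun v h => by simp at h⟩

/-- The vertex set `[m] × [n]`. -/
def gridVertices (m n : ℕ) : Set (ℤ × ℤ) :=
  {v | (1 ≤ v.1 ∧ v.1 ≤ m) ∧ (1 ≤ v.2 ∧ v.2 ≤ n)}

/-- The rectangular grid-graph with `m` vertices in each row and `n` vertices in each column: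
the subgraph of the square lattice induced by `[m] × [n]`. -/
def rectGrid (m n : ℕ) : squareLattice.Subgraph :=
  (⊤ : squareLattice.Subgraph).induce (gridVertices m n)

/-- The vertical edges of the leftmost and of the rightmost column. -/
def sideEdges (m n : ℕ) : Set (Sym2 (ℤ × ℤ)) :=
  {e | ∃ y : ℤ, (1 ≤ y ∧ y ≤ (n : ℤ) - 1) ∧
    (e = s((1, y), (1, y + 1)) ∨ e = s(((m : ℤ), y), ((m : ℤ), y + 1)))}

/-- The board `S_{m × n}`. -/
def board (m n : ℕ) : squareLattice.Subgraph :=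
  (rectGrid m n).deleteEdges (sideEdges m n)

theorem gridVertices_finite (m n : ℕ) : (gridVertices m n).Finite := by
  refine ((Set.finite_Icc (1 : ℤ) m).prod (Set.finite_Icc (1 : ℤ) n)).subset ?_
  intro v hv
  exact ⟨hv.1, hv.2⟩

theorem board_edgeSet_finite (m n : ℕ) : (board m n).edgeSet.Finite := by
  refine (((gridVertices_finite m n).prod (gridVertices_finite m n)).image
    (fun q : (ℤ × ℤ) × (ℤ × ℤ) => s(q.1, q.2))).subset ?_
  intro e
  induction e using Sym2.ind with
  | _ v w =>
    intro h
    rw [SimpleGraph.Subgraph.mem_edgeSet] at h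
    exact ⟨(v, w), ⟨(board m n).edge_vert h, (board m n).edge_vert h.symm⟩, rfl⟩

/-- The finite set of edges of `S_{m × n}`; these are what the players claim. -/
noncomputable def boardEdges (m n : ℕ) : Finset (Sym2 (ℤ × ℤ)) :=
  (board_edgeSet_finite m n).toFinset

/-- `C` contains all the edges of a left-right crossing path of `S_{m × n}`, that is, of a path
in `S_{m × n}` from a vertex `(1, y)` to a vertex `(m, y')`. -/
def ContainsCrossing (m n : ℕ) (C : Finset (Sym2 (ℤ × ℤ))) : Prop :=
  ∃ (y y' : ℤ) (w : squareLattice.Walk (1, y) ((m : ℤ), y')),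
    w.IsPath ∧ w.toSubgraph ≤ board m n ∧ ∀ e ∈ w.edges, e ∈ C

/-- A record of the sets claimed by the two players in turns `0, 1, 2, …` (round `i` consists of
`maker i` followed by `breaker i`). Play goes on after the winner is decided, which changes
nothing about who wins; once the board is exhausted the players claim empty sets. -/
structure Play (E : Type*) where
  maker : ℕ → Finset E
  breaker : ℕ → Finset E

namespace Play

variable {E : Type*} [DecidableEq E]

/-- The edges claimed by Maker during the first `k` rounds. -/
def makerClaimed (P : Play E) (k : ℕ) : Finset E := (Finset.range k).biUnion P.maker

/-- The edges claimed by Breaker during the first `k` rounds. -/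
def breakerClaimed (P : Play E) (k : ℕ) : Finset E := (Finset.range k).biUnion P.breaker

/-- The complete record of the first `k` rounds. -/
def history (P : Play E) (k : ℕ) : List (Finset E × Finset E) :=
  (List.range k).map fun j => (P.maker j, P.breaker j)

end Play

/-- A legal turn of a player who claims `r` edges per turn, when the set of unclaimed edges is
`U`: she claims exactly `r` unclaimed edges, or all of them if there are fewer than `r`. -/
def LegalTurn {E : Type*} (r : ℕ) (U C : Finset E) : Prop :=
  C ⊆ U ∧ C.card = min r U.card

/-- Maker's turn in round `k` is legal on the set of edges `X`. -/
def MakerLegal {E : Type*} [DecidableEq E] (X : Finset E) (p : ℕ) (P : Play E) (k : ℕ) : Prop :=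
  LegalTurn p (X \ (P.makerClaimed k ∪ P.breakerClaimed k)) (P.maker k)

/-- Breaker's turn in round `k`, which comes after Maker's turn in round `k`, is legal on the
set of edges `X`. -/
def BreakerLegal {E : Type*} [DecidableEq E] (X : Finset E) (q : ℕ) (P : Play E) (k : ℕ) : Prop :=
  LegalTurn q (X \ (P.makerClaimed (k + 1) ∪ P.breakerClaimed k)) (P.breaker k)

/-- At some point Maker has claimed all the edges of a left-right crossing path. -/
def MakerWins (m n : ℕ) (P : Play (Sym2 (ℤ × ℤ))) : Prop :=
  ∃ k, ContainsCrossing m n (P.makerClaimed k)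

/-- At some point Maker can no longer ever claim a left-right crossing path: every such path has
an edge claimed by Breaker. -/
def BreakerWins (m n : ℕ) (P : Play (Sym2 (ℤ × ℤ))) : Prop :=
  ∃ k, ¬ ContainsCrossing m n (boardEdges m n \ P.breakerClaimed k)

/-- Maker has a winning strategy for the `(p, q)`-crossing game on `S_{m × n}`. A strategy tells
her what to claim, given the record of all earlier rounds; it is winning if, as long as Breaker
plays legally, it only makes legal moves and Maker wins. -/
def MakerHasWinningStrategy (p q m n : ℕ) : Prop :=
  ∃ σ : List (Finset (Sym2 (ℤ × ℤ)) × Finset (Sym2 (ℤ × ℤ))) → Finset (Sym2 (ℤ × ℤ)),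
    ∀ P : Play (Sym2 (ℤ × ℤ)),
      (∀ k, P.maker k = σ (P.history k)) →
      (∀ k, BreakerLegal (boardEdges m n) q P k) →
      (∀ k, MakerLegal (boardEdges m n) p P k) ∧ MakerWins m n P

/-- Breaker has a winning strategy for the `(p, q)`-crossing game on `S_{m × n}`. A strategy
tells him what to claim, given the record of all earlier rounds and Maker's turn in the current
round. -/
def BreakerHasWinningStrategy (p q m n : ℕ) : Prop :=
  ∃ τ : List (Finset (Sym2 (ℤ × ℤ)) × Finset (Sym2 (ℤ × ℤ))) → Finset (Sym2 (ℤ × ℤ)) →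
      Finset (Sym2 (ℤ × ℤ)),
    ∀ P : Play (Sym2 (ℤ × ℤ)),
      (∀ k, P.breaker k = τ (P.history k) (P.maker k)) →
      (∀ k, MakerLegal (boardEdges m n) p P k) →
      (∀ k, BreakerLegal (boardEdges m n) q P k) ∧ BreakerWins m n P

end CrossingGame

/-!
Both parts come from strategy stealing in the square-like case `S_{(n + 1) × n}`, whose planar dual
is another copy of itself.

The game is first relaxed (`FirstCanWin`): turns consist of at most `p` edges, and after a fixed
number of rounds all remaining edges go to the first player. In this form extra moves visibly never
hurt, so a winning strategy carries over to the actual game, even when the actual board is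
larger than the board of the relaxed game
(`makerHasWinningStrategy_of_firstCanWin`, `breakerHasWinningStrategy_of_firstCanWin`). If the first
player of the relaxed game had no winning strategy, her opponent could defend against everything;
she could then skip her first turn and copy this defence through the duality. So the first player
wins as soon as there is an involution of the board taking each set whose complement is not
winning to a winning set (`firstCanWin_of_involution`).

For the board `S_{(n + 1) × n}` the involution is planar duality `dualEdge`. Connections are
handled through `Separated`: a set of edges contains no crossing iff some function on the vertices
is `0` on the left, `1` on the right and constant along the edges of the set
(`containsCrossing_of_not_separated`, `not_separated_of_containsCrossing`). Two facts are needed.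
If Breaker's edges leave no crossing, then their duals contain one
(`not_separated_image_dualEdge`): otherwise there are separating functions on the vertices and on
the faces such that every edge is constant for one of them, whereas a discrete Stokes formula says
that the products of their differences sum to `1`. If the duals contain a crossing, then the
remaining edges contain none (`separated_sdiff_image_dualEdge`): counting signed intersections of
the dual path with a ray gives a separating function.

If `m ≤ n + 1`, Maker plays on `m - 1` of the rows as first player. If `(p + 1) * (n + 1) ≤ m`, the
board contains `p + 1` disjoint copies of `S_{(n + 1) × n}`, each spanning all the rows; Maker's
first turn misses one of them, Breaker becomes the first player there, and blocking this copy blocks the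
board.
-/

namespace CrossingGame

/-! ### The record of a play -/

namespace Play

theorem length_history {E : Type*} (P : Play E) (k : ℕ) : (P.history k).length = k := by
  simp [history]

/-- The first turn of Maker can be read off the record available to Breaker. -/
theorem headI_history {E : Type*} (P : Play E) (k : ℕ) :
    ((P.history k).map Prod.fst ++ [P.maker k]).headI = P.maker 0 := by
  cases k <;> simp [history, List.range_succ_eq_map]

end Play

/-! ### A relaxed positional game and strategy stealing -/

section Game

variable {E : Type*} [DecidableEq E]

/-- The first player can win the relaxed game on `Y` within `k` rounds, from the position in which
she has claimed `A`, her opponent has claimed `B`, and she is to move. In the relaxed game a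
turn consists of at most `p` edges, which may repeat edges the same player already has; after the
last round the first player receives all of `Y` except her opponent's edges, and she wins if `W`
holds for the result. -/
def FirstCanWin (Y : Finset E) (W : Finset E → Prop) (p : ℕ) :
    ℕ → Finset E → Finset E → Prop
  | 0, _, B => W (Y \ B)
  | k + 1, A, B => ∃ C ⊆ Y, C.card ≤ p ∧ Disjoint C B ∧
      ∀ D ⊆ Y, D.card ≤ p → Disjoint D (A ∪ C) → FirstCanWin Y W p k (A ∪ C) (B ∪ D)

variable {X Y : Finset E} {W : Finset E → Prop} {p : ℕ}

/-- Extra edges of one's own, or fewer edges of the opponent, never hurt. -/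
theorem FirstCanWin.mono (hW : Monotone W) : ∀ {k : ℕ} {A A' B B' : Finset E},
    A ⊆ A' → B' ⊆ B → FirstCanWin Y W p k A B → FirstCanWin Y W p k A' B'
  | 0, _, _, _, _, _, hB, h => hW (Finset.sdiff_subset_sdiff le_rfl hB) h
  | k + 1, A, A', B, B', hA, hB, h => by
    obtain ⟨C, hCY, hCp, hCB, h⟩ := h
    refine ⟨C, hCY, hCp, hCB.mono_right hB, fun D hDY hDp hD => ?_⟩
    have hAC : A ∪ C ⊆ A' ∪ C := Finset.union_subset_union_left hA
    exact FirstCanWin.mono hW hAC (Finset.union_subset_union_left hB)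
      (h D hDY hDp (hD.mono_right hAC))

/-- Strategy stealing, in a position with the roles of the players exchanged by `φ`: if the
first player cannot win from `(A, B)`, then she wins from the position obtained by applying `φ`,
exchanging the colours, and letting her opponent move first, since she can imitate the
opponent's defence. -/
theorem firstCanWin_swap (hW : Monotone W) {φ : E → E} (hφY : ∀ e ∈ Y, φ e ∈ Y)
    (hφφ : ∀ e ∈ Y, φ (φ e) = e) (hd : ∀ S ⊆ Y, ¬ W (Y \ S) → W (S.image φ)) :
    ∀ (k : ℕ) {A B D : Finset E}, A ⊆ Y → B ⊆ Y → Disjoint A B →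
      ¬ FirstCanWin Y W p k A B → D ⊆ Y → D.card ≤ p → Disjoint D (B.image φ) →
      FirstCanWin Y W p k (B.image φ) (A.image φ ∪ D) := by
  have himg : ∀ {S : Finset E}, S ⊆ Y → S.image φ ⊆ Y := fun hS =>
    Finset.image_subset_iff.2 fun e he => hφY e (hS he)
  have hback : ∀ {S : Finset E}, S ⊆ Y → (S.image φ).image φ = S := fun {S} hS => by
    rw [Finset.image_image]
    exact (Finset.image_congr fun e he => hφφ e (hS he)).trans Finset.image_id
  have hdisj : ∀ {S T : Finset E}, S ⊆ Y → T ⊆ Y → Disjoint S T →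
      Disjoint (S.image φ) (T.image φ) := by
    intro S T hS hT h
    refine Finset.disjoint_left.2 fun e he he' => ?_
    obtain ⟨s, hs, rfl⟩ := Finset.mem_image.1 he
    obtain ⟨t, ht, hts⟩ := Finset.mem_image.1 he'
    have : t = s := by rw [← hφφ t (hT ht), hts, hφφ s (hS hs)]
    exact Finset.disjoint_left.1 h hs (this ▸ ht)
  intro k
  induction k with
  | zero =>
    intro A B D hA hB hAB h hD _ hDB
    refine hW (fun e he => ?_) (hd B hB h)
    refine Finset.mem_sdiff.2 ⟨himg hB he, fun he' => ?_⟩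
    rcases Finset.mem_union.1 he' with he' | he'
    · exact Finset.disjoint_left.1 (hdisj hA hB hAB) he' he
    · exact Finset.disjoint_left.1 hDB he' he
  | succ k ih =>
    intro A B D hA hB hAB h hD hDp hDB
    have hDB' : Disjoint (D.image φ) B := by
      have := hdisj hD (himg hB) hDB
      rwa [hback hB] at this
    simp only [FirstCanWin, not_exists, not_and, not_forall] at h
    obtain ⟨D', hD'Y, hD'p, hD'A, h⟩ :=
      h (D.image φ) (himg hD) (Finset.card_image_le.trans hDp) hDB'
    have hA' : A ∪ D.image φ ⊆ Y := Finset.union_subset hA (himg hD)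
    have hdj : Disjoint (D'.image φ) (A.image φ ∪ D) := by
      have := hdisj hD'Y hA' hD'A
      rwa [Finset.image_union, hback hD] at this
    refine ⟨D'.image φ, himg hD'Y, Finset.card_image_le.trans hD'p, hdj,
      fun D₂ hD₂ hD₂p hD₂A => ?_⟩
    have hAB' : Disjoint (A ∪ D.image φ) (B ∪ D') :=
      Finset.disjoint_union_right.2 ⟨Finset.disjoint_union_left.2 ⟨hAB, hDB'⟩, hD'A.symm⟩
    have := ih (D := D₂) hA' (Finset.union_subset hB hD'Y) hAB' h hD₂ hD₂p
      (by rwa [Finset.image_union])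
    rwa [Finset.image_union, Finset.image_union, hback hD] at this

/-- If an involution `φ` of `Y` turns every set whose complement is not winning into a winning
set, then the first player wins the relaxed game. -/
theorem firstCanWin_of_involution (hW : Monotone W) {φ : E → E} (hφY : ∀ e ∈ Y, φ e ∈ Y)
    (hφφ : ∀ e ∈ Y, φ (φ e) = e) (hd : ∀ S ⊆ Y, ¬ W (Y \ S) → W (S.image φ)) (k : ℕ) :
    FirstCanWin Y W p k ∅ ∅ := by
  by_contra h
  refine h ?_
  simpa using firstCanWin_swap (A := ∅) (B := ∅) (D := ∅) hW hφY hφφ hd k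
    (Finset.empty_subset _) (Finset.empty_subset _) (Finset.disjoint_empty_left _) h
    (Finset.empty_subset _) (by simp) (Finset.disjoint_empty_left _)

/-! ### From the relaxed game to the actual game -/

/-- The specification of a good turn `C` in the actual game on `X`: it is legal, and it preserves
the property of being a winning position of the relaxed game on `Y`. -/
def GoodTurn (X Y : Finset E) (W : Finset E → Prop) (p k : ℕ) (A B C : Finset E) : Prop :=
  LegalTurn p (X \ (A ∪ B)) C ∧ (FirstCanWin Y W p (k + 1) (A ∩ Y) (B ∩ Y) →
    ∀ D ⊆ X \ ((A ∪ C) ∪ B), D.card ≤ p →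
      FirstCanWin Y W p k ((A ∪ C) ∩ Y) ((B ∪ D) ∩ Y))

theorem exists_goodTurn (hYX : Y ⊆ X) (hW : Monotone W) (k : ℕ) (A B : Finset E) :
    ∃ C, GoodTurn X Y W p k A B C := by
  have hmin : min p (X \ (A ∪ B)).card ≤ (X \ (A ∪ B)).card := min_le_right _ _
  by_cases h : FirstCanWin Y W p (k + 1) (A ∩ Y) (B ∩ Y)
  · obtain ⟨C, hCY, hCp, hCB, h⟩ := h
    have hsub : C \ A ⊆ X \ (A ∪ B) := by
      intro e he
      obtain ⟨heC, heA⟩ := Finset.mem_sdiff.1 he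
      have heB : e ∉ B := fun heB =>
        Finset.disjoint_left.1 hCB heC (Finset.mem_inter.2 ⟨heB, hCY heC⟩)
      simp [heA, heB, hYX (hCY heC)]
    have hcard : (C \ A).card ≤ min p (X \ (A ∪ B)).card :=
      le_min ((Finset.card_le_card Finset.sdiff_subset).trans hCp) (Finset.card_le_card hsub)
    obtain ⟨C', hC', hC'U, hC'card⟩ := Finset.exists_subsuperset_card_eq hsub hcard hmin
    refine ⟨C', ⟨hC'U, hC'card⟩, fun _ D hD hDp => ?_⟩
    have hle : A ∩ Y ∪ C ⊆ (A ∪ C') ∩ Y := by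
      intro e he
      rcases Finset.mem_union.1 he with he | he
      · exact Finset.inter_subset_inter_right Finset.subset_union_left he
      · refine Finset.mem_inter.2 ⟨?_, hCY he⟩
        by_cases heA : e ∈ A
        · exact Finset.mem_union_left _ heA
        · exact Finset.mem_union_right _ (hC' (Finset.mem_sdiff.2 ⟨he, heA⟩))
    refine FirstCanWin.mono hW hle ?_ (h (D ∩ Y) Finset.inter_subset_right
      ((Finset.card_le_card Finset.inter_subset_left).trans hDp) ?_)
    · rw [Finset.union_inter_distrib_right]
    · refine Finset.disjoint_left.2 fun e he he' => ?_
      have h1 := (Finset.mem_sdiff.1 (hD (Finset.mem_inter.1 he).1)).2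
      exact h1 (Finset.mem_union_left _ (Finset.mem_inter.1 (hle he')).1)
  · obtain ⟨C, hCU, hC⟩ := Finset.exists_subset_card_eq hmin
    exact ⟨C, ⟨hCU, hC⟩, fun h' => absurd h' h⟩

/-- A good turn, chosen once and for all as a function of the position. -/
noncomputable def goodTurn (X Y : Finset E) (W : Finset E → Prop) (p k : ℕ) (A B : Finset E) :
    Finset E :=
  Classical.epsilon (GoodTurn X Y W p k A B)

theorem goodTurn_spec (hYX : Y ⊆ X) (hW : Monotone W) (k : ℕ) (A B : Finset E) :
    GoodTurn X Y W p k A B (goodTurn X Y W p k A B) :=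
  Classical.epsilon_spec (exists_goodTurn hYX hW k A B)

namespace Play

variable (P : Play E)

theorem makerClaimed_succ (k : ℕ) : P.makerClaimed (k + 1) = P.makerClaimed k ∪ P.maker k := by
  simp [makerClaimed, Finset.range_add_one, Finset.biUnion_insert, Finset.union_comm]

theorem breakerClaimed_succ (k : ℕ) :
    P.breakerClaimed (k + 1) = P.breakerClaimed k ∪ P.breaker k := by
  simp [breakerClaimed, Finset.range_add_one, Finset.biUnion_insert, Finset.union_comm]

theorem biUnion_fst_history (k : ℕ) :
    (P.history k).toFinset.biUnion Prod.fst = P.makerClaimed k := by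
  ext e; simp [history, makerClaimed]

theorem biUnion_snd_history (k : ℕ) :
    (P.history k).toFinset.biUnion Prod.snd = P.breakerClaimed k := by
  ext e; simp [history, breakerClaimed]

end Play

/-- Since Maker claims an edge in every round, `X.card` rounds exhaust the board. -/
theorem subset_claimed_of_makerLegal (hp : 1 ≤ p) {P : Play E}
    (h : ∀ k, MakerLegal X p P k) :
    X ⊆ P.makerClaimed X.card ∪ P.breakerClaimed X.card := by
  have key : ∀ k, (X \ (P.makerClaimed k ∪ P.breakerClaimed k)).card ≤ X.card - k := by
    intro k
    induction k with
    | zero => exact Finset.card_le_card Finset.sdiff_subset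
    | succ k ih =>
      obtain ⟨hsub, hcard⟩ := h k
      have hle : X \ (P.makerClaimed (k + 1) ∪ P.breakerClaimed (k + 1)) ⊆
          (X \ (P.makerClaimed k ∪ P.breakerClaimed k)) \ P.maker k := by
        rw [P.makerClaimed_succ, P.breakerClaimed_succ]
        intro e
        simp only [Finset.mem_sdiff, Finset.mem_union]
        tauto
      have := Finset.card_le_card hle
      rw [Finset.card_sdiff_of_subset hsub] at this
      omega
  have h0 := key X.card
  rw [Nat.sub_self, Nat.le_zero, Finset.card_eq_zero, Finset.sdiff_eq_empty_iff_subset] at h0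
  exact h0

/-- Maker turns a winning strategy of the relaxed game on a part `Y` of the board into a winning
strategy of the actual game. -/
theorem makerHasWinningStrategy_of_firstCanWin {m n : ℕ}
    {Y : Finset (Sym2 (ℤ × ℤ))} {W : Finset (Sym2 (ℤ × ℤ)) → Prop} (hp : 1 ≤ p)
    (hYX : Y ⊆ boardEdges m n) (hW : Monotone W) (hwin : ∀ k, FirstCanWin Y W p k ∅ ∅)
    (hcross : ∀ S, W S → ContainsCrossing m n S) : MakerHasWinningStrategy p p m n := by
  set X := boardEdges m n
  refine ⟨fun h => goodTurn X Y W p (X.card - h.length - 1) (h.toFinset.biUnion Prod.fst)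
    (h.toFinset.biUnion Prod.snd), fun P hσ hB => ?_⟩
  simp only [P.length_history, P.biUnion_fst_history, P.biUnion_snd_history] at hσ
  have good : ∀ k, GoodTurn X Y W p (X.card - k - 1) (P.makerClaimed k) (P.breakerClaimed k)
      (P.maker k) := fun k => hσ k ▸ goodTurn_spec hYX hW _ _ _
  have legal : ∀ k, MakerLegal X p P k := fun k => (good k).1
  have inv : ∀ k ≤ X.card, FirstCanWin Y W p (X.card - k) (P.makerClaimed k ∩ Y)
      (P.breakerClaimed k ∩ Y) := by
    intro k
    induction k with
    | zero => intro _; simpa [Play.makerClaimed, Play.breakerClaimed] using hwin X.card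
    | succ k ih =>
      intro hk
      have h1 := ih (by omega)
      rw [show X.card - k = X.card - k - 1 + 1 by omega] at h1
      have h2 := hB k
      rw [BreakerLegal, P.makerClaimed_succ] at h2
      have h3 := (good k).2 h1 (P.breaker k) h2.1 (h2.2.trans_le (min_le_left _ _))
      rwa [← P.makerClaimed_succ, ← P.breakerClaimed_succ] at h3
  refine ⟨legal, X.card, hcross _ (hW ?_ (by simpa [FirstCanWin] using inv X.card le_rfl))⟩
  intro e he
  have := subset_claimed_of_makerLegal hp legal
  have := this (hYX (Finset.mem_sdiff.1 he).1)
  simp only [Finset.mem_sdiff, Finset.mem_union] at *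
  tauto

/-- Breaker wins if, whatever Maker does in her first turn, there is an untouched part of the
board on which the first player wins the relaxed game for a condition that implies blocking all
crossings. -/
theorem breakerHasWinningStrategy_of_firstCanWin {m n : ℕ} {ι : Type*} [Nonempty ι]
    {Y : ι → Finset (Sym2 (ℤ × ℤ))} {W : ι → Finset (Sym2 (ℤ × ℤ)) → Prop} (hp : 1 ≤ p)
    (hYX : ∀ i, Y i ⊆ boardEdges m n) (hW : ∀ i, Monotone (W i))
    (hwin : ∀ i k, FirstCanWin (Y i) (W i) p k ∅ ∅)
    (huntouched : ∀ C : Finset (Sym2 (ℤ × ℤ)), C.card ≤ p → ∃ i, Disjoint C (Y i))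
    (hblock : ∀ i S, W i S → ¬ ContainsCrossing m n (boardEdges m n \ S)) :
    BreakerHasWinningStrategy p p m n := by
  set X := boardEdges m n
  let part : Finset (Sym2 (ℤ × ℤ)) → ι := fun C => Classical.epsilon fun i => Disjoint C (Y i)
  have hpart : ∀ C, C.card ≤ p → Disjoint C (Y (part C)) := fun C hC =>
    Classical.epsilon_spec (p := fun i => Disjoint C (Y i)) (huntouched C hC)
  refine ⟨fun h c => goodTurn X (Y (part (h.map Prod.fst ++ [c]).headI))
    (W (part (h.map Prod.fst ++ [c]).headI)) p (X.card - h.length - 1)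
    (h.toFinset.biUnion Prod.snd) (h.toFinset.biUnion Prod.fst ∪ c), fun P hτ hM => ?_⟩
  simp only [P.length_history, P.biUnion_fst_history, P.biUnion_snd_history,
    P.headI_history, ← P.makerClaimed_succ] at hτ
  set i := part (P.maker 0)
  have good : ∀ k, GoodTurn X (Y i) (W i) p (X.card - k - 1) (P.breakerClaimed k)
      (P.makerClaimed (k + 1)) (P.breaker k) := fun k => hτ k ▸ goodTurn_spec (hYX i) (hW i) _ _ _
  have inv : ∀ k ≤ X.card, FirstCanWin (Y i) (W i) p (X.card - k) (P.breakerClaimed k ∩ Y i)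
      (P.makerClaimed (k + 1) ∩ Y i) := by
    intro k
    induction k with
    | zero =>
      intro _
      have h0 : P.maker 0 ∩ Y i = ∅ := Finset.disjoint_iff_inter_eq_empty.1
        (hpart _ ((hM 0).2.trans_le (min_le_left _ _)))
      simpa [Play.makerClaimed, Play.breakerClaimed, h0] using hwin i X.card
    | succ k ih =>
      intro hk
      have h1 := ih (by omega)
      rw [show X.card - k = X.card - k - 1 + 1 by omega] at h1
      have h2 := hM (k + 1)
      rw [MakerLegal, P.breakerClaimed_succ, Finset.union_comm] at h2
      have h3 := (good k).2 h1 (P.maker (k + 1)) h2.1 (h2.2.trans_le (min_le_left _ _))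
      rwa [← P.makerClaimed_succ, ← P.breakerClaimed_succ] at h3
  refine ⟨fun k => ?_, X.card, hblock i _ (hW i ?_
    (by simpa [FirstCanWin] using inv X.card le_rfl))⟩
  · have := (good k).1
    rwa [Finset.union_comm] at this
  · intro e he
    have := subset_claimed_of_makerLegal hp hM
    have := this (hYX i (Finset.mem_sdiff.1 he).1)
    simp only [P.makerClaimed_succ, Finset.mem_sdiff, Finset.mem_union] at *
    tauto

end Game

/-! ### Separating potentials -/

/-- The horizontal edge with left endpoint `(x, y)`. -/
def hEdge (x y : ℤ) : Sym2 (ℤ × ℤ) := s((x, y), (x + 1, y))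

/-- The vertical edge with lower endpoint `(x, y)`. -/
def vEdge (x y : ℤ) : Sym2 (ℤ × ℤ) := s((x, y), (x, y + 1))

/-- The edges of `S` do not connect the left side to the right side of the copy of `S_{m × n}`
whose leftmost column is `{x = o + 1}`: there is a function on the vertices that is `0` on the
left side, `1` on the right side, and constant along the edges of this copy that belong to `S`.
The coordinates of the copy are taken relative to the offset `o`. -/
def Separated (o m n : ℤ) (S : Finset (Sym2 (ℤ × ℤ))) : Prop :=
  ∃ f : ℤ → ℤ → ℤ, (∀ y, 1 ≤ y → y ≤ n → f 1 y = 0 ∧ f m y = 1) ∧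
    (∀ x y, 1 ≤ x → x + 1 ≤ m → 1 ≤ y → y ≤ n → hEdge (o + x) y ∈ S → f (x + 1) y = f x y) ∧
    (∀ x y, 2 ≤ x → x + 1 ≤ m → 1 ≤ y → y + 1 ≤ n → vEdge (o + x) y ∈ S →
      f x (y + 1) = f x y)

theorem Separated.anti {o m n n' : ℤ} {S T : Finset (Sym2 (ℤ × ℤ))} (h : Separated o m n T)
    (hn : n' ≤ n) (hST : S ⊆ T) : Separated o m n' S := by
  obtain ⟨f, hf, hh, hv⟩ := h
  exact ⟨f, fun y h1 h2 => hf y h1 (by omega),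
    fun x y h1 h2 h3 h4 h5 => hh x y h1 h2 h3 (by omega) (hST h5),
    fun x y h1 h2 h3 h4 h5 => hv x y h1 h2 h3 (by omega) (hST h5)⟩

/-- Separating the two sides of a part of the board consisting of consecutive columns separates
the two sides of the board: extend the potential by constants. -/
theorem Separated.extend {o l m n : ℤ} (ho : 0 ≤ o) (hl : 1 < l) (hm : o + l ≤ m)
    {S : Finset (Sym2 (ℤ × ℤ))} (h : Separated o l n S) : Separated 0 m n S := by
  obtain ⟨f, hf, hh, hv⟩ := h
  refine ⟨fun x y => if x - o ≤ 1 then 0 else if l ≤ x - o then 1 else f (x - o) y,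
    fun y _ _ => ⟨if_pos (by omega), ?_⟩, fun x y _ _ h3 h4 h5 => ?_,
    fun x y _ _ h3 h4 h5 => ?_⟩
  · exact (if_neg (by omega)).trans (if_pos (by omega))
  · rw [zero_add] at h5
    obtain ⟨hf1, hfl⟩ := hf y h3 h4
    rcases lt_or_ge (x - o) 1 with h1 | h1
    · simp only [if_pos (show x - o ≤ 1 by omega), if_pos (show x + 1 - o ≤ 1 by omega)]
    rcases le_or_gt l (x - o) with h2 | h2
    · simp only [if_neg (show ¬ x - o ≤ 1 by omega), if_neg (show ¬ x + 1 - o ≤ 1 by omega),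
        if_pos h2, if_pos (show l ≤ x + 1 - o by omega)]
    have key := hh (x - o) y h1 (by omega) h3 h4 (by rwa [add_sub_cancel])
    rw [show x - o + 1 = x + 1 - o by ring] at key
    have e1 : (if x - o ≤ 1 then 0 else if l ≤ x - o then 1 else f (x - o) y) = f (x - o) y := by
      split_ifs with h
      · rw [show x - o = 1 by omega, hf1]
      · omega
      · rfl
    have e2 : (if x + 1 - o ≤ 1 then 0 else if l ≤ x + 1 - o then 1 else f (x + 1 - o) y) =
        f (x + 1 - o) y := by
      split_ifs with h h'
      · omega
      · rw [show x + 1 - o = l by omega, hfl]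
      · rfl
    exact (e2.trans key).trans e1.symm
  · rw [zero_add] at h5
    dsimp only
    split_ifs with h1 h2
    · rfl
    · rfl
    · exact hv (x - o) y (by omega) (by omega) h3 h4 (by rwa [add_sub_cancel])

/-- A step along an edge of `S` in the copy of `S_{m × n}` with offset `o`, in relative
coordinates. -/
inductive Step (o m n : ℤ) (S : Finset (Sym2 (ℤ × ℤ))) : ℤ × ℤ → ℤ × ℤ → Prop
  | right {x y : ℤ} (h1 : 1 ≤ x) (h2 : x + 1 ≤ m) (h3 : 1 ≤ y) (h4 : y ≤ n)
      (h : hEdge (o + x) y ∈ S) : Step o m n S (x, y) (x + 1, y)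
  | left {x y : ℤ} (h1 : 1 ≤ x) (h2 : x + 1 ≤ m) (h3 : 1 ≤ y) (h4 : y ≤ n)
      (h : hEdge (o + x) y ∈ S) : Step o m n S (x + 1, y) (x, y)
  | up {x y : ℤ} (h1 : 2 ≤ x) (h2 : x + 1 ≤ m) (h3 : 1 ≤ y) (h4 : y + 1 ≤ n)
      (h : vEdge (o + x) y ∈ S) : Step o m n S (x, y) (x, y + 1)
  | down {x y : ℤ} (h1 : 2 ≤ x) (h2 : x + 1 ≤ m) (h3 : 1 ≤ y) (h4 : y + 1 ≤ n)
      (h : vEdge (o + x) y ∈ S) : Step o m n S (x, y + 1) (x, y)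

theorem exists_reflTransGen_of_not_separated {o m n : ℤ} {S : Finset (Sym2 (ℤ × ℤ))}
    (h : ¬ Separated o m n S) : ∃ y y' : ℤ, (1 ≤ y ∧ y ≤ n) ∧ (1 ≤ y' ∧ y' ≤ n) ∧
      Relation.ReflTransGen (Step o m n S) (1, y) (m, y') := by
  classical
  by_contra hno
  -- otherwise the complement of the set of vertices reachable from the left side separates
  let R : ℤ × ℤ → Prop := fun v =>
    ∃ y : ℤ, (1 ≤ y ∧ y ≤ n) ∧ Relation.ReflTransGen (Step o m n S) (1, y) v
  have hR : ∀ {v w}, Step o m n S v w → R v → R w := fun hvw ⟨y, hy, hv⟩ => ⟨y, hy, hv.tail hvw⟩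
  refine h ⟨fun x y => if R (x, y) then 0 else 1, fun y h1 h2 => ⟨?_, ?_⟩,
    fun x y h1 h2 h3 h4 h5 => ?_, fun x y h1 h2 h3 h4 h5 => ?_⟩
  · exact if_pos ⟨y, ⟨h1, h2⟩, .refl⟩
  · exact if_neg fun ⟨y₀, hy₀, hv⟩ => hno ⟨y₀, y, hy₀, ⟨h1, h2⟩, hv⟩
  · exact if_congr ⟨hR (.left h1 h2 h3 h4 h5), hR (.right h1 h2 h3 h4 h5)⟩ rfl rfl
  · exact if_congr ⟨hR (.down h1 h2 h3 h4 h5), hR (.up h1 h2 h3 h4 h5)⟩ rfl rfl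

/-! ### Edges and crossings of the board -/

theorem mem_boardEdges {m n : ℕ} {v w : ℤ × ℤ} :
    s(v, w) ∈ boardEdges m n ↔ (board m n).Adj v w := by
  rw [boardEdges, Set.Finite.mem_toFinset, SimpleGraph.Subgraph.mem_edgeSet]

theorem board_adj {m n : ℕ} {v w : ℤ × ℤ} : (board m n).Adj v w ↔
    v ∈ gridVertices m n ∧ w ∈ gridVertices m n ∧ squareLattice.Adj v w ∧
      s(v, w) ∉ sideEdges m n := by
  simp [board, rectGrid, and_assoc]

theorem board_verts {m n : ℕ} : (board m n).verts = gridVertices m n := rfl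

theorem hEdge_mem_boardEdges {m n : ℕ} {x y : ℤ} (h1 : 1 ≤ x) (h2 : x + 1 ≤ m) (h3 : 1 ≤ y)
    (h4 : y ≤ n) : hEdge x y ∈ boardEdges m n := by
  rw [hEdge, mem_boardEdges, board_adj]
  refine ⟨⟨⟨h1, by dsimp; omega⟩, h3, h4⟩, ⟨⟨by dsimp; omega, h2⟩, h3, h4⟩, ?_, ?_⟩
  · change (x - (x + 1)) ^ 2 + (y - y) ^ 2 = 1
    ring
  · rintro ⟨z, -, h | h⟩ <;> simp only [Sym2.eq_iff, Prod.mk.injEq] at h <;> omega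

theorem vEdge_mem_boardEdges {m n : ℕ} {x y : ℤ} (h1 : 2 ≤ x) (h2 : x + 1 ≤ m) (h3 : 1 ≤ y)
    (h4 : y + 1 ≤ n) : vEdge x y ∈ boardEdges m n := by
  rw [vEdge, mem_boardEdges, board_adj]
  refine ⟨⟨⟨by dsimp; omega, by dsimp; omega⟩, h3, by dsimp; omega⟩,
    ⟨⟨by dsimp; omega, by dsimp; omega⟩, by dsimp; omega, h4⟩, ?_, ?_⟩
  · change (x - x) ^ 2 + (y - (y + 1)) ^ 2 = 1
    ring
  · rintro ⟨z, -, h | h⟩ <;> simp only [Sym2.eq_iff, Prod.mk.injEq] at h <;> omega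

/-- Two adjacent vertices of the board are joined by a horizontal edge, or by a vertical edge in
one of the inner columns. -/
theorem board_adj_cases {m n : ℕ} {v w : ℤ × ℤ} (h : (board m n).Adj v w) :
    ∃ x y : ℤ, 1 ≤ y ∧
      ((1 ≤ x ∧ x + 1 ≤ m ∧ y ≤ n ∧ s(v, w) = hEdge x y) ∨
        (2 ≤ x ∧ x + 1 ≤ m ∧ y + 1 ≤ n ∧ s(v, w) = vEdge x y)) := by
  obtain ⟨⟨⟨a1, a2⟩, a3, a4⟩, ⟨⟨b1, b2⟩, b3, b4⟩, hadj, hside⟩ := board_adj.1 h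
  obtain ⟨a, b⟩ := v
  obtain ⟨c, d⟩ := w
  change (a - c) ^ 2 + (b - d) ^ 2 = 1 at hadj
  dsimp only at *
  have hne : ∀ x y : ℤ, s((a, b), (c, d)) = vEdge x y → 1 ≤ y → y + 1 ≤ n → x ≠ 1 ∧ x ≠ m :=
    fun x y e h1 h2 => ⟨fun hx => hside ⟨y, ⟨h1, by omega⟩, .inl (by rw [e, hx]; rfl)⟩,
      fun hx => hside ⟨y, ⟨h1, by omega⟩, .inr (by rw [e, hx]; rfl)⟩⟩
  have h1 : a - c ≤ 1 := by nlinarith [sq_nonneg (b - d)]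
  have h2 : -1 ≤ a - c := by nlinarith [sq_nonneg (b - d)]
  have h3 : b - d ≤ 1 := by nlinarith [sq_nonneg (a - c)]
  have h4 : -1 ≤ b - d := by nlinarith [sq_nonneg (a - c)]
  have hcase : (c = a + 1 ∧ d = b) ∨ (a = c + 1 ∧ d = b) ∨ (c = a ∧ d = b + 1) ∨
      (c = a ∧ b = d + 1) := by
    have hx : a - c = -1 ∨ a - c = 0 ∨ a - c = 1 := by omega
    have hy : b - d = -1 ∨ b - d = 0 ∨ b - d = 1 := by omega
    rcases hx with hx | hx | hx <;> rcases hy with hy | hy | hy <;> rw [hx, hy] at hadj <;>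
      norm_num at hadj <;> omega
  rcases hcase with ⟨rfl, rfl⟩ | ⟨rfl, rfl⟩ | ⟨rfl, rfl⟩ | ⟨rfl, rfl⟩
  · exact ⟨a, d, a3, .inl ⟨a1, b2, a4, rfl⟩⟩
  · exact ⟨c, d, b3, .inl ⟨b1, a2, b4, Sym2.eq_swap⟩⟩
  · obtain ⟨n1, n2⟩ := hne c b rfl a3 b4
    exact ⟨c, b, a3, .inr ⟨by omega, by omega, b4, rfl⟩⟩
  · obtain ⟨n1, n2⟩ := hne c d Sym2.eq_swap b3 a4
    exact ⟨c, d, b3, .inr ⟨by omega, by omega, a4, Sym2.eq_swap⟩⟩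

theorem not_separated_of_containsCrossing {m n : ℕ} {C : Finset (Sym2 (ℤ × ℤ))}
    (h : ContainsCrossing m n C) : ¬ Separated 0 m n C := by
  rintro ⟨f, hf, hh, hv⟩
  obtain ⟨y, y', w, -, hw, hC⟩ := h
  have hend : ∀ v ∈ w.support, v ∈ gridVertices m n := fun v hv =>
    hw.1 ((w.mem_verts_toSubgraph).2 hv)
  obtain ⟨-, hy1, hy2⟩ := hend _ w.start_mem_support
  obtain ⟨-, hy1', hy2'⟩ := hend _ w.end_mem_support
  have key : ∀ {u v : ℤ × ℤ} (w : squareLattice.Walk u v),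
      (∀ e ∈ w.edges, e ∈ C ∧ e ∈ boardEdges m n) → f v.1 v.2 = f u.1 u.2 := by
    intro u v w
    induction w with
    | nil => intro _; rfl
    | @cons u u' v hadj w ih =>
      intro he
      simp only [SimpleGraph.Walk.edges_cons, List.mem_cons, forall_eq_or_imp] at he
      rw [ih he.2]
      obtain ⟨x, y, h3, h | h⟩ := board_adj_cases (mem_boardEdges.1 he.1.2)
      · obtain ⟨h1, h2, h4, e⟩ := h
        have := hh x y h1 h2 h3 h4 (by rw [zero_add, ← e]; exact he.1.1)
        rcases Sym2.eq_iff.1 e with ⟨rfl, rfl⟩ | ⟨rfl, rfl⟩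
        · exact this
        · exact this.symm
      · obtain ⟨h1, h2, h4, e⟩ := h
        have := hv x y h1 h2 h3 h4 (by rw [zero_add, ← e]; exact he.1.1)
        rcases Sym2.eq_iff.1 e with ⟨rfl, rfl⟩ | ⟨rfl, rfl⟩
        · exact this
        · exact this.symm
  have hconst := key w fun e he => ⟨hC e he, by
    induction e using Sym2.ind with
    | _ a b => exact mem_boardEdges.2 (hw.2 (w.mem_edges_toSubgraph.2 he))⟩
  have := (hf y hy1 hy2).1
  have := (hf y' hy1' hy2').2
  dsimp only at hconst
  omega

theorem containsCrossing_of_not_separated {m n : ℕ} (hm : 1 ≤ m) {C : Finset (Sym2 (ℤ × ℤ))}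
    (h : ¬ Separated 0 m n C) : ContainsCrossing m n C := by
  classical
  obtain ⟨y, y', hy, -, hr⟩ := exists_reflTransGen_of_not_separated h
  have hstep : ∀ {v w}, Step 0 m n C v w → (board m n).Adj v w ∧ s(v, w) ∈ C := by
    rintro _ _ (⟨h1, h2, h3, h4, h⟩ | ⟨h1, h2, h3, h4, h⟩ | ⟨h1, h2, h3, h4, h⟩ |
      ⟨h1, h2, h3, h4, h⟩) <;> rw [zero_add] at h
    · exact ⟨mem_boardEdges.1 (hEdge_mem_boardEdges h1 h2 h3 h4), h⟩
    · exact ⟨(mem_boardEdges.1 (hEdge_mem_boardEdges h1 h2 h3 h4)).symm, Sym2.eq_swap ▸ h⟩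
    · exact ⟨mem_boardEdges.1 (vEdge_mem_boardEdges h1 h2 h3 h4), h⟩
    · exact ⟨(mem_boardEdges.1 (vEdge_mem_boardEdges h1 h2 h3 h4)).symm, Sym2.eq_swap ▸ h⟩
  have hwalk : ∀ v, Relation.ReflTransGen (Step 0 m n C) (1, y) v →
      ∃ w : squareLattice.Walk (1, y) v, w.toSubgraph ≤ board m n ∧ ∀ e ∈ w.edges, e ∈ C := by
    intro v hr
    induction hr with
    | refl =>
      refine ⟨.nil, ?_, by simp⟩
      rw [SimpleGraph.Walk.toSubgraph, SimpleGraph.singletonSubgraph_le_iff, board_verts]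
      exact ⟨⟨le_rfl, Nat.one_le_cast.2 hm⟩, hy⟩
    | tail _ hs ih =>
      obtain ⟨w, hw, hC⟩ := ih
      obtain ⟨hadj, hmem⟩ := hstep hs
      refine ⟨w.concat hadj.adj_sub, ?_, ?_⟩
      · rw [SimpleGraph.Walk.concat_eq_append, SimpleGraph.Walk.toSubgraph_append]
        refine sup_le hw ?_
        rw [SimpleGraph.Walk.toSubgraph, SimpleGraph.Walk.toSubgraph]
        exact sup_le (SimpleGraph.subgraphOfAdj_le_of_adj _ hadj)
          ((SimpleGraph.singletonSubgraph_le_iff _ _).2 hadj.snd_mem)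
      · intro e he
        rw [SimpleGraph.Walk.edges_concat, List.concat_eq_append, List.mem_append,
          List.mem_singleton] at he
        rcases he with he | rfl
        · exact hC e he
        · exact hmem
  obtain ⟨w, hw, hC⟩ := hwalk _ hr
  refine ⟨y, y', w.bypass, w.bypass_isPath, ?_, fun e he => hC e (w.edges_bypass_subset_edges he)⟩
  refine le_trans ⟨fun v hv => ?_, fun a b hab => ?_⟩ hw
  · rw [SimpleGraph.Walk.mem_verts_toSubgraph] at *
    exact w.support_bypass_subset_support hv
  · rw [← SimpleGraph.Subgraph.mem_edgeSet, SimpleGraph.Walk.mem_edges_toSubgraph] at *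
    exact w.edges_bypass_subset_edges hab

/-! ### Planar duality on boards with one more column than rows -/

/-- The edges of the copy of `S_{(n + 1) × n}` whose leftmost column is `{x = o + 1}`. -/
noncomputable def squareEdges (o n : ℤ) : Finset (Sym2 (ℤ × ℤ)) :=
  (Finset.Icc 1 n ×ˢ Finset.Icc 1 n).image (fun q => hEdge (o + q.1) q.2) ∪
    (Finset.Icc 2 n ×ˢ Finset.Icc 1 (n - 1)).image (fun q => vEdge (o + q.1) q.2)

theorem mem_squareEdges {o n : ℤ} {e : Sym2 (ℤ × ℤ)} : e ∈ squareEdges o n ↔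
    (∃ x y, (1 ≤ x ∧ x ≤ n) ∧ (1 ≤ y ∧ y ≤ n) ∧ hEdge (o + x) y = e) ∨
      ∃ x y, (2 ≤ x ∧ x ≤ n) ∧ (1 ≤ y ∧ y ≤ n - 1) ∧ vEdge (o + x) y = e := by
  simp [squareEdges, and_assoc]

theorem squareEdges_subset_boardEdges {o n : ℤ} {m n' : ℕ} (ho : 0 ≤ o) (hm : o + (n + 1) ≤ m)
    (hn : n ≤ n') : squareEdges o n ⊆ boardEdges m n' := by
  intro e he
  rcases mem_squareEdges.1 he with ⟨x, y, hx, hy, rfl⟩ | ⟨x, y, hx, hy, rfl⟩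
  · exact hEdge_mem_boardEdges (by omega) (by omega) hy.1 (by omega)
  · exact vEdge_mem_boardEdges (by omega) (by omega) hy.1 (by omega)

/-- Only the edges of the copy of the board matter for separation. -/
theorem Separated.of_forall_mem {o n : ℤ} {S T : Finset (Sym2 (ℤ × ℤ))}
    (h : Separated o (n + 1) n T) (hST : ∀ e ∈ squareEdges o n, e ∈ S → e ∈ T) :
    Separated o (n + 1) n S := by
  obtain ⟨f, hf, hh, hv⟩ := h
  exact ⟨f, hf, fun x y h1 h2 h3 h4 he => hh x y h1 h2 h3 h4 (hST _ (mem_squareEdges.2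
      (.inl ⟨x, y, ⟨h1, by omega⟩, ⟨h3, h4⟩, rfl⟩)) he),
    fun x y h1 h2 h3 h4 he => hv x y h1 h2 h3 h4 (hST _ (mem_squareEdges.2
      (.inr ⟨x, y, ⟨h1, by omega⟩, ⟨h3, by omega⟩, rfl⟩)) he)⟩

/-- The sum of the two endpoints of an edge, which is twice its midpoint. -/
def endpointSum (e : Sym2 (ℤ × ℤ)) : ℤ × ℤ :=
  Sym2.lift ⟨fun v w => v + w, fun v w => add_comm v w⟩ e

theorem endpointSum_bounds {o n : ℤ} {e : Sym2 (ℤ × ℤ)} (he : e ∈ squareEdges o n) :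
    2 * o + 2 ≤ (endpointSum e).1 ∧ (endpointSum e).1 ≤ 2 * o + 2 * n + 1 := by
  rcases mem_squareEdges.1 he with ⟨x, y, hx, -, rfl⟩ | ⟨x, y, hx, -, rfl⟩ <;>
    simp only [endpointSum, hEdge, vEdge, Sym2.lift_mk, Prod.mk_add_mk] <;> omega

/-- Planar duality for `S_{(n + 1) × n}`, with offset `o`. The planar dual of this board is
another copy of it, turned by a quarter; the map sends an edge `e` to the edge whose dual crosses
`e`, after the two copies are identified by a reflection. It is computed from the midpoint: a
point with doubled coordinates `(a, b)`, relative to the offset, goes to `(b + 1, a - 1)`, and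
rounding the halves of `a` and `b` down and up recovers the endpoints. -/
def dualEdge (o : ℤ) (e : Sym2 (ℤ × ℤ)) : Sym2 (ℤ × ℤ) :=
  let a := (endpointSum e).2 + 1 + 2 * o
  let b := (endpointSum e).1 - 1 - 2 * o
  s((a / 2, b / 2), ((a + 1) / 2, (b + 1) / 2))

theorem dualEdge_hEdge (o x y : ℤ) : dualEdge o (hEdge (o + x) y) = hEdge (o + y) x := by
  simp only [dualEdge, endpointSum, hEdge, Sym2.lift_mk, Prod.mk_add_mk]
  congr 3 <;> omega

theorem dualEdge_vEdge (o x y : ℤ) :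
    dualEdge o (vEdge (o + x) y) = vEdge (o + (y + 1)) (x - 1) := by
  simp only [dualEdge, endpointSum, vEdge, Sym2.lift_mk, Prod.mk_add_mk]
  congr 3 <;> omega

theorem dualEdge_mem_squareEdges {o n : ℤ} : ∀ e ∈ squareEdges o n,
    dualEdge o e ∈ squareEdges o n := by
  intro e he
  rcases mem_squareEdges.1 he with ⟨x, y, hx, hy, rfl⟩ | ⟨x, y, hx, hy, rfl⟩
  · exact mem_squareEdges.2 (.inl ⟨y, x, hy, hx, (dualEdge_hEdge o x y).symm⟩)
  · exact mem_squareEdges.2 (.inr ⟨y + 1, x - 1, by omega, by omega, (dualEdge_vEdge o x y).symm⟩)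

theorem dualEdge_dualEdge {o n : ℤ} : ∀ e ∈ squareEdges o n, dualEdge o (dualEdge o e) = e := by
  intro e he
  rcases mem_squareEdges.1 he with ⟨x, y, -, -, rfl⟩ | ⟨x, y, -, -, rfl⟩
  · rw [dualEdge_hEdge, dualEdge_hEdge]
  · rw [dualEdge_vEdge, dualEdge_vEdge, sub_add_cancel, add_sub_cancel_right]

/-- Summation by parts. -/
theorem sum_mul_sub (a b : ℕ → ℤ) (r : ℕ) :
    ∑ j ∈ Finset.range (r + 1), a j * (b (j + 1) - b j) =
      a r * b (r + 1) - a 0 * b 0 - ∑ j ∈ Finset.range r, (a (j + 1) - a j) * b (j + 1) := by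
  induction r with
  | zero => simp; ring
  | succ r ih => rw [Finset.sum_range_succ, ih, Finset.sum_range_succ _ r]; ring

/-- Let `F` be a function on the vertices of the board and `G` one on the faces, each `0` on one
of its two boundary sides and `1` on the other. The sum over all edges of the (signed) products of
the difference of `F` along the edge and of `G` across the edge is then `1`, as summation by parts
in both directions shows; so the products cannot all vanish. -/
theorem exists_mul_ne_zero (r : ℕ) (F G : ℕ → ℕ → ℤ)
    (hF₀ : ∀ j ≤ r, F 0 j = 0) (hF₁ : ∀ j ≤ r, F (r + 1) j = 1)
    (hG₀ : ∀ i ≤ r, G i 0 = 0) (hG₁ : ∀ i ≤ r, G i (r + 1) = 1)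
    (hH : ∀ i ≤ r, ∀ j ≤ r, (F (i + 1) j - F i j) * (G i (j + 1) - G i j) = 0)
    (hV : ∀ i < r, ∀ j < r,
      (F (i + 1) (j + 1) - F (i + 1) j) * (G (i + 1) (j + 1) - G i (j + 1)) = 0) : False := by
  -- the sum over the horizontal edges, summed by parts along the columns
  have hcol : ∀ i ∈ Finset.range (r + 1), F (i + 1) r - F i r =
      ∑ j ∈ Finset.range r, ((F (i + 1) (j + 1) - F i (j + 1)) - (F (i + 1) j - F i j)) *
        G i (j + 1) := by
    intro i hi
    have hi' : i ≤ r := by simpa [Nat.lt_succ_iff] using hi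
    have h := sum_mul_sub (fun j => F (i + 1) j - F i j) (G i) r
    rw [Finset.sum_eq_zero fun j hj => hH i hi' j (by simpa [Nat.lt_succ_iff] using hj),
      hG₀ i hi', hG₁ i hi'] at h
    linarith
  -- the remaining double sum, summed by parts along the rows, involves only vertical edges
  have hrow : ∀ j ∈ Finset.range r, ∑ i ∈ Finset.range (r + 1),
      ((F (i + 1) (j + 1) - F i (j + 1)) - (F (i + 1) j - F i j)) * G i (j + 1) = 0 := by
    intro j hj
    have hj' : j < r := Finset.mem_range.1 hj
    have h := sum_mul_sub (fun i => G i (j + 1)) (fun i => F i (j + 1) - F i j) r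
    rw [Finset.sum_eq_zero (s := Finset.range r) fun i hi => by
      rw [mul_comm]; exact hV i (Finset.mem_range.1 hi) j hj'] at h
    rw [hF₀ _ hj', hF₀ _ hj'.le, hF₁ _ hj', hF₁ _ hj'.le] at h
    rw [← sub_zero (0 : ℤ)]
    refine Eq.trans (Finset.sum_congr rfl fun i _ => ?_) (h.trans (by ring))
    ring
  have h1 : ∑ i ∈ Finset.range (r + 1), (F (i + 1) r - F i r) = 1 := by
    rw [Finset.sum_range_sub (fun i => F i r), hF₀ r le_rfl, hF₁ r le_rfl, sub_zero]
  rw [Finset.sum_congr rfl hcol, Finset.sum_comm, Finset.sum_eq_zero hrow] at h1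
  exact zero_ne_one h1

/-- A set of edges and the dual of its complement cannot both fail to connect their sides. -/
theorem not_separated_image_dualEdge {o : ℤ} {n : ℕ} (hn : 1 ≤ n) {S : Finset (Sym2 (ℤ × ℤ))}
    (h : Separated o (n + 1) n (squareEdges o n \ S)) :
    ¬ Separated o (n + 1) n (S.image (dualEdge o)) := by
  rintro ⟨g, hg, hgh, hgv⟩
  obtain ⟨f, hf, hfh, hfv⟩ := h
  obtain ⟨r, rfl⟩ := Nat.exists_eq_add_of_le' hn
  -- the dual potential `g`, viewed on the faces: face `(i, j)` is dual to the vertex `(j, i)`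
  refine exists_mul_ne_zero r (fun i j => f (i + 1) (j + 1)) (fun i j => g (j + 1) (i + 1))
    (fun j hj => ?_) (fun j hj => ?_) (fun i hi => ?_) (fun i hi => ?_)
    (fun i hi j hj => ?_) (fun i hi j hj => ?_)
  · simpa using (hf (j + 1) (by omega) (by push_cast; omega)).1
  · simpa using (hf (j + 1) (by omega) (by push_cast; omega)).2
  · simpa using (hg (i + 1) (by omega) (by push_cast; omega)).1
  · simpa using (hg (i + 1) (by omega) (by push_cast; omega)).2
  · push_cast at *
    by_cases he : hEdge (o + (i + 1)) (j + 1) ∈ S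
    · have := hgh (j + 1) (i + 1) (by omega) (by omega) (by omega) (by omega)
        (Finset.mem_image.2 ⟨_, he, dualEdge_hEdge o _ _⟩)
      rw [this, sub_self, mul_zero]
    · have := hfh (i + 1) (j + 1) (by omega) (by omega) (by omega) (by omega)
        (Finset.mem_sdiff.2 ⟨mem_squareEdges.2
          (.inl ⟨_, _, ⟨by omega, by omega⟩, ⟨by omega, by omega⟩, rfl⟩), he⟩)
      rw [this, sub_self, zero_mul]
  · push_cast at *
    by_cases he : vEdge (o + (i + 1 + 1)) (j + 1) ∈ S
    · have := hgv (j + 1 + 1) (i + 1) (by omega) (by omega) (by omega) (by omega)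
        (Finset.mem_image.2 ⟨_, he, (dualEdge_vEdge o _ _).trans (by rw [add_sub_cancel_right])⟩)
      rw [this, sub_self, mul_zero]
    · have := hfv (i + 1 + 1) (j + 1) (by omega) (by omega) (by omega) (by omega)
        (Finset.mem_sdiff.2 ⟨mem_squareEdges.2
          (.inr ⟨_, _, ⟨by omega, by omega⟩, ⟨by omega, by omega⟩, rfl⟩), he⟩)
      rw [this, sub_self, zero_mul]

/-- A set of edges and the dual of its complement cannot both connect their sides. The potential
at a vertex `(x, y)` is the signed number of times that a path in `S`, regarded as a path of
the dual board, crosses the horizontal ray from `(x, y)` to the left. -/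
theorem separated_sdiff_image_dualEdge {o : ℤ} {n : ℕ} {S : Finset (Sym2 (ℤ × ℤ))}
    (h : ¬ Separated o (n + 1) n S) :
    Separated o (n + 1) n (squareEdges o n \ S.image (dualEdge o)) := by
  obtain ⟨b, b', -, -, hr⟩ := exists_reflTransGen_of_not_separated h
  -- `t y` jumps where the dual path crosses row `y`; `q x y` marks the faces between the rows
  -- `y` and `y + 1` to the left of column `x`
  let t : ℤ → ℤ × ℤ → ℤ := fun y u => if y < u.1 then 1 else 0
  let q : ℤ → ℤ → ℤ × ℤ → ℤ := fun x y u => if u.1 = y + 1 ∧ u.2 < x then 1 else 0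
  have key : ∀ u, Relation.ReflTransGen (Step o (n + 1) n S) (1, b) u → ∃ F : ℤ → ℤ → ℤ,
      (∀ y, F 1 y = 0) ∧ (∀ y, F (n + 1) y = t y u - t y (1, b)) ∧
      (∀ x y, hEdge (o + y) x ∉ S → F (x + 1) y = F x y) ∧
      (∀ x y, vEdge (o + (y + 1)) (x - 1) ∉ S →
        F x (y + 1) = F x y - (q x y u - q x y (1, b))) := by
    intro u hu
    induction hu with
    | refl => exact ⟨fun _ _ => 0, by simp⟩
    | @tail u v _ hs ih =>
      obtain ⟨F, h1, h2, h3, h4⟩ := ih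
      refine ⟨fun x y => F x y + if u.2 < x then t y v - t y u else 0, fun y => ?_, fun y => ?_,
        fun x y he => ?_, fun x y he => ?_⟩
      · have : ¬ u.2 < 1 := by cases hs <;> dsimp only <;> omega
        dsimp only
        rw [h1, if_neg this, add_zero]
      · have : u.2 < n + 1 := by cases hs <;> dsimp only <;> omega
        dsimp only
        rw [h2, if_pos this]
        ring
      · dsimp only
        rw [h3 x y he]
        congr 1
        cases hs with
        | @right a c _ _ _ _ hm =>
          have : ¬ (a = y ∧ c = x) := by rintro ⟨rfl, rfl⟩; exact he hm
          simp only [t]; split_ifs <;> omega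
        | @left a c _ _ _ _ hm =>
          have : ¬ (a = y ∧ c = x) := by rintro ⟨rfl, rfl⟩; exact he hm
          simp only [t]; split_ifs <;> omega
        | up => simp [t]
        | down => simp [t]
      · dsimp only
        rw [h4 x y he]
        cases hs with
        | @right a c => simp only [t, q]; split_ifs <;> omega
        | @left a c => simp only [t, q]; split_ifs <;> omega
        | @up a c _ _ _ _ hm =>
          have : ¬ (a = y + 1 ∧ c = x - 1) := by rintro ⟨rfl, rfl⟩; exact he hm
          simp only [t, q]; split_ifs <;> omega
        | @down a c _ _ _ _ hm =>
          have : ¬ (a = y + 1 ∧ c = x - 1) := by rintro ⟨rfl, rfl⟩; exact he hm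
          simp only [t, q]; split_ifs <;> omega
  obtain ⟨F, h1, h2, h3, h4⟩ := key _ hr
  refine ⟨F, fun y hy hy' => ⟨h1 y, ?_⟩, fun x y _ _ _ _ he => h3 x y fun hS => ?_,
    fun x y _ _ hy hy' he => ?_⟩
  · rw [h2]
    simp only [t]
    rw [if_pos (by omega), if_neg (by omega), sub_zero]
  · exact (Finset.mem_sdiff.1 he).2 (Finset.mem_image.2 ⟨_, hS, dualEdge_hEdge o y x⟩)
  · rw [h4 x y fun hS => (Finset.mem_sdiff.1 he).2 (Finset.mem_image.2 ⟨_, hS, ?_⟩)]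
    · simp only [q]
      rw [if_neg (by omega), if_neg (by omega), sub_self, sub_zero]
    · rw [dualEdge_vEdge, sub_add_cancel, add_sub_cancel_right]

/-! ### The two players' strategies -/

theorem makerHasWinningStrategy_of_le {p m n : ℕ} (hp : 1 ≤ p) (hm : 1 ≤ m) (hn : 1 ≤ n)
    (hmn : m ≤ n + 1) : MakerHasWinningStrategy p p m n := by
  obtain ⟨r, rfl⟩ := Nat.exists_eq_add_of_le' hm
  have hW : Monotone fun S => ¬ Separated 0 ((r + 1 : ℕ) : ℤ) r S :=
    fun S T hST h hT => h (hT.anti le_rfl hST)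
  rcases Nat.eq_zero_or_pos r with rfl | hr
  · -- with a single column, a vertex is a crossing path
    refine makerHasWinningStrategy_of_firstCanWin (Y := ∅) (W := fun _ => True) hp
      (Finset.empty_subset _) (fun _ _ _ h => h)
      (firstCanWin_of_involution (φ := id) (fun _ _ _ h => h) (by simp) (by simp) (by simp))
      fun S _ => containsCrossing_of_not_separated le_rfl ?_
    rintro ⟨f, hf, -⟩
    have h := hf 1 le_rfl (by exact_mod_cast hn)
    rw [Nat.cast_one] at h
    omega
  · refine makerHasWinningStrategy_of_firstCanWin (Y := squareEdges 0 r) hp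
      (squareEdges_subset_boardEdges le_rfl (by push_cast; omega) (by omega)) hW
      (firstCanWin_of_involution hW dualEdge_mem_squareEdges dualEdge_dualEdge ?_)
      fun S hS => containsCrossing_of_not_separated hm
        fun h => hS (h.anti (by omega) le_rfl)
    intro S _ h
    have h' := not_not.1 h
    push_cast at h' ⊢
    exact not_separated_image_dualEdge hr h'

theorem breakerHasWinningStrategy_of_le {p m n : ℕ} (hp : 1 ≤ p) (hn : 1 ≤ n)
    (hmn : (p + 1) * (n + 1) ≤ m) : BreakerHasWinningStrategy p p m n := by
  let o : Fin (p + 1) → ℤ := fun i => ((i * (n + 1) : ℕ) : ℤ)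
  have ho : ∀ i, 0 ≤ o i := fun i => Int.natCast_nonneg _
  have hom : ∀ i, o i + ((n : ℤ) + 1) ≤ m := fun i => by
    have : ((i : ℕ) + 1) * (n + 1) ≤ m := (Nat.mul_le_mul_right _ (by omega)).trans hmn
    rw [add_mul, one_mul] at this
    simp only [o]
    exact_mod_cast this
  have hsub : ∀ i, squareEdges (o i) n ⊆ boardEdges m n := fun i =>
    squareEdges_subset_boardEdges (ho i) (hom i) le_rfl
  have hW : ∀ i, Monotone fun S => Separated (o i) (n + 1) n (squareEdges (o i) n \ S) :=
    fun i S T hST h => h.anti le_rfl (Finset.sdiff_subset_sdiff le_rfl hST)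
  refine breakerHasWinningStrategy_of_firstCanWin hp hsub hW
    (fun i => firstCanWin_of_involution (hW i) dualEdge_mem_squareEdges dualEdge_dualEdge
      fun S hS h => ?_) (fun C hC => ?_) fun i S h => ?_
  · rw [Finset.sdiff_sdiff_eq_self hS] at h
    exact separated_sdiff_image_dualEdge h
  · -- the `p + 1` parts are disjoint, so one of them avoids the `p` edges of `C`
    by_contra! hno
    choose e heC heY using fun i => Finset.not_disjoint_iff.1 (hno i)
    obtain ⟨i, -, j, -, hij, he⟩ := Finset.exists_ne_map_eq_of_card_lt_of_maps_to
      (s := Finset.univ) (t := C) (by simpa using Nat.lt_succ_of_le hC) (f := e)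
      fun i _ => heC i
    have hle : ∀ {i j : Fin (p + 1)}, e i = e j → (i : ℕ) ≤ j := by
      intro i j he
      have h1 := (endpointSum_bounds (heY i)).1
      have h2 := (endpointSum_bounds (heY j)).2
      rw [he] at h1
      have h3 : (i : ℕ) * (n + 1) < (j + 1) * (n + 1) := by
        have : o i < o j + ((n : ℤ) + 1) := by omega
        rw [add_mul, one_mul]
        simp only [o] at this
        exact_mod_cast this
      exact Nat.lt_succ_iff.1 (Nat.lt_of_mul_lt_mul_right h3)
    exact hij (Fin.ext ((hle he).antisymm (hle he.symm)))
  · intro hc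
    refine not_separated_of_containsCrossing hc (Separated.extend (ho i) (by omega) (hom i)
      (h.of_forall_mem fun e heY he => ?_))
    exact Finset.mem_sdiff.2 ⟨heY, (Finset.mem_sdiff.1 he).2⟩

end CrossingGame

theorem mainTheorem6 (p m n : ℕ) (hp : 1 ≤ p) (hm : 1 ≤ m) (hn : 1 ≤ n) :
    (m ≤ n + 1 → CrossingGame.MakerHasWinningStrategy p p m n) ∧
    ((p + 1) * (n + 1) ≤ m → CrossingGame.BreakerHasWinningStrategy p p m n) :=
  ⟨CrossingGame.makerHasWinningStrategy_of_le hp hm hn,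
    CrossingGame.breakerHasWinningStrategy_of_le hp hn⟩
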